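/- **Model.** Let $N=\{1,\dots,n\}$, $n\ge 3$, be a set of agents. A network $G$ is a set of ordered pairs $ij$ of different agents (directed edges); $G+ij=G\cup\{ij\}$, $G-ij=G\setminus\{ij\}$. An edge $ki\in G$ with $ik\notin G$ is called single, and $k$ is then a subordinate of $i$; if $ij,ji\in G$, the edge is undirected. Let $\mathcal N_{\rm out}(i,G)=\{j: ij\in G\}$, $\mathcal N^s_{\rm in}(i,G)=\{k: ki\in G,\ ik\notin G\}$, $P_i(G,k)=\{i\}\cup\{j: kj,ij,ji\in G\}$ and $P_i(G)=\bigcap_{k\in\mathcal N^s_{\rm in}(i,G)}P_i(G,k)$. Let $\Gamma(i,G)$ be the set of agents in the strongly connected component of $i$, and let the level $\ell_i(G)$ be the largest number of arcs of a path in the condensation graph of $G$ from some source to the component of $i$. A component is undirected if all edges between its agents are undirected. An undirected edge $ij,ji\in G$ in an undirected component is critical if $\Gamma(i,G)\ne\Gamma(i,G-ij)$. Connected means weakly connected. Given constants $\gamma,c>0$ and a non-negative strictly increasing function $H$ on the non-negative integers, the utility of agent $i$ is $$u_i(G)=\gamma\,|\mathcal N_{\rm out}(i,G)|+H(\ell_i(G))-c\sum_{k\in\mathcal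 N^s_{\rm in}(i,G)}\frac1{|P_i(G,k)|}.$$ Either all agents are non-consensual or all agents are consensual. $G$ is an equilibrium network if for all $i\ne j$: when $ij\in G$, $u_i(G)>u_i(G-ij)$; when $ij\notin G$, $u_i(G)>u_i(G+ij)$ or, for consensual agents only, alternatively $u_i(G)\le u_i(G+ij)$ and $u_j(G)>u_j(G+ij)$. **Process.** $G(0)=G_o$. At the times $t=0,1,\dots$ ordered pairs $(i,j)$ of agents are drawn independently from one fixed distribution that gives positive probability exactly to the pairs with $i\ne j$. If $ij\in G(t)$, then $G(t+1)=G(t)-ij$ when $u_i(G(t)-ij)\ge u_i(G(t))$. If $ij\notin G(t)$, then $G(t+1)=G(t)+ij$ when $u_i(G(t)+ij)\ge u_i(G(t))$ and, for consensual agents, also $u_j(G(t)+ij)\ge u_j(G(t))$. Otherwise $G(t+1)=G(t)$. **Theorem.** Suppose that $H(\ell+1)-H(\ell)>\gamma+cn$ for every integer $0\le\ell\le n-1$. Then, for either type of agents and every initial network $G_o$, with probability one there are a finite time $T$ and a network $G^*$ such that $G(t)=G^*$ for all $t\ge T$, and $G^*$ is a connected equilibrium network with no critical edges. All strongly connected components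 of $G^*$ are undirected. Moreover, writing $\ell_i=\ell_i(G^*)$: * for non-consensual agents, agents of $G^*$ with the same level are in the same strongly connected component, there is a single edge from $i$ to $j$ whenever $\ell_i<\ell_j$, and whenever $\ell_i=\ell_j+1$, $$H(\ell_i)-H(\ell_j)>\gamma+c\,\frac{|P_i(G^*)|+|\{m:\ell_m<\ell_i\}|}{|P_i(G^*)|\,(|P_i(G^*)|+1)};$$ * for consensual agents, for every subordinate $j$ of $i$ in $G^*$, $$H(\ell_i)-H(\ell_j)>\gamma+c\sum_{p\in\mathcal N^s_{\rm in}(i,G^*)\setminus\{j\}}\frac{|P_i(G^*+ij,p)|-|P_i(G^*,p)|}{|P_i(G^*,p)|\,|P_i(G^*+ij,p)|}+\frac{c}{|P_i(G^*,j)|}>0,$$ and $H(\ell_i+1)-H(\ell_j)<c$ for all $i,j$ with $\ell_j\le\ell_i$ such that $G^*$ has no directed path from $j$ to $i$ (paths of length zero are allowed). -/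

import Mathlib

open MeasureTheory ProbabilityTheory

namespace HierNet

/-! ### Directed networks, identified with their edge sets -/

/-- A set of directed edges on the agents `0, …, n - 1`; `(i, j) ∈ G` is the edge from `i` to `j`
(`j` supervises `i`, unless `(j, i) ∈ G` as well, in which case `i` and `j` collaborate). -/
abbrev EdgeSet (n : ℕ) := Finset (Fin n × Fin n)

variable {n : ℕ}

/-- Edges of a network join different agents. -/
def IsNetwork (G : EdgeSet n) : Prop := ∀ e ∈ G, e.1 ≠ e.2

/-- `G + ij`. -/
def addEdge (G : EdgeSet n) (i j : Fin n) : EdgeSet n := insert (i, j) G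

/-- `G - ij`. -/
def delEdge (G : EdgeSet n) (i j : Fin n) : EdgeSet n := G.erase (i, j)

/-- The out-neighbours of `i`. -/
def outNbrs (G : EdgeSet n) (i : Fin n) : Finset (Fin n) :=
  Finset.univ.filter fun j => (i, j) ∈ G

/-- The subordinates of `i`: the in-neighbours `k` of `i` whose edge `ki` is a single edge. -/
def subordinates (G : EdgeSet n) (i : Fin n) : Finset (Fin n) :=
  Finset.univ.filter fun k => (k, i) ∈ G ∧ (i, k) ∉ G

/-- `P_i(G, k)`: the agent `i` and its collaborators that have an edge from `k`. -/
def teamOver (G : EdgeSet n) (i k : Fin n) : Finset (Fin n) :=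
  insert i (Finset.univ.filter fun j => (k, j) ∈ G ∧ (i, j) ∈ G ∧ (j, i) ∈ G)

/-- `P_i(G)`: the intersection of the sets `P_i(G, k)` over the subordinates `k` of `i`. -/
def team (G : EdgeSet n) (i : Fin n) : Finset (Fin n) :=
  Finset.univ.filter fun j => ∀ k ∈ subordinates G i, j ∈ teamOver G i k

/-- There is a (possibly trivial) directed path from `i` to `j`. -/
def Reach (G : EdgeSet n) (i j : Fin n) : Prop :=
  Relation.ReflTransGen (fun a b => (a, b) ∈ G) i j

/-- `G` is weakly connected. -/
def IsConnected (G : EdgeSet n) : Prop :=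
  ∀ i j : Fin n, Relation.ReflTransGen (fun a b => (a, b) ∈ G ∨ (b, a) ∈ G) i j

/-! ### Strongly connected components, condensation graph, levels -/

/-- Two agents are strongly connected if each can be reached from the other. -/
def strongSetoid (G : EdgeSet n) : Setoid (Fin n) where
  r i j := Reach G i j ∧ Reach G j i
  iseqv :=
    { refl := fun _ => ⟨Relation.ReflTransGen.refl, Relation.ReflTransGen.refl⟩
      symm := fun h => ⟨h.2, h.1⟩
      trans := fun h h' => ⟨h.1.trans h'.1, h'.2.trans h.2⟩ }

/-- The strongly connected components of `G`. -/
abbrev Component (G : EdgeSet n) : Type := Quotient (strongSetoid G)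

/-- The strongly connected component of `i`, as a node of the condensation graph. -/
def componentOf (G : EdgeSet n) (i : Fin n) : Component G := Quotient.mk (strongSetoid G) i

/-- `Γ(i, G)`: the set of the agents in the strongly connected component of `i`. -/
def component (G : EdgeSet n) (i : Fin n) : Set (Fin n) := {j | Reach G i j ∧ Reach G j i}

/-- The condensation graph `C(G)`. -/
def condensation (G : EdgeSet n) : Digraph (Component G) where
  Adj A B := A ≠ B ∧ ∃ a b : Fin n, componentOf G a = A ∧ componentOf G b = B ∧ (a, b) ∈ G

/-- The level of a node `v` of a directed acyclic graph `D` on a finite set of nodes: the largest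
number of arcs of a path from some source of `D` to `v`. -/
noncomputable def dagLevel {W : Type*} (D : Digraph W) (v : W) : ℕ :=
  sSup {m | ∃ p : RelSeries {e : W × W | D.Adj e.1 e.2},
    (∀ w, ¬ D.Adj w p.head) ∧ p.last = v ∧ p.length = m}

/-- `ℓ_i(C(G))`: the level of agent `i` in the network `G`. -/
noncomputable def level (G : EdgeSet n) (i : Fin n) : ℕ :=
  dagLevel (condensation G) (componentOf G i)

/-- Every edge inside the strongly connected component of `i` is undirected. -/
def HasUndirectedComponent (G : EdgeSet n) (i : Fin n) : Prop :=
  ∀ a ∈ component G i, ∀ b ∈ component G i, (a, b) ∈ G → (b, a) ∈ G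

/-- `ij, ji ∈ G` is a critical edge: it belongs to an undirected component, and removing `ij`
changes the strongly connected component of `i`. -/
def IsCritical (G : EdgeSet n) (i j : Fin n) : Prop :=
  HasUndirectedComponent G i ∧ (i, j) ∈ G ∧ (j, i) ∈ G ∧
    component G i ≠ component (delEdge G i j) i

/-! ### The game -/

/-- Whether the agents need the agreement of the other endpoint to establish an edge. -/
inductive AgentType
  | nonConsensual
  | consensual

/-- The parameters of a hierarchical network formation game. -/
structure Game where
  /-- the subordinate-collaborative reward per link -/
  γ : ℝ
  /-- the management cost constant -/
  c : ℝ
  /-- the reward function -/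
  H : ℕ → ℝ
  /-- the common type of all agents -/
  agentType : AgentType
  γ_pos : 0 < γ
  c_pos : 0 < c
  H_nonneg : ∀ l, 0 ≤ H l
  H_strictMono : StrictMono H

/-- The utility `u_i(G)`. -/
noncomputable def utility (g : Game) (G : EdgeSet n) (i : Fin n) : ℝ :=
  ((outNbrs G i).card : ℝ) * g.γ + g.H (level G i)
    - g.c * ∑ k ∈ subordinates G i, 1 / ((teamOver G i k).card : ℝ)

/-- Equilibrium networks. -/
def IsEquilibrium (g : Game) (G : EdgeSet n) : Prop :=
  ∀ i j : Fin n, i ≠ j →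
    ((i, j) ∈ G → utility g (delEdge G i j) i < utility g G i) ∧
    ((i, j) ∉ G →
      match g.agentType with
      | .nonConsensual => utility g (addEdge G i j) i < utility g G i
      | .consensual =>
          utility g (addEdge G i j) i < utility g G i ∨
            (utility g G i ≤ utility g (addEdge G i j) i ∧
              utility g (addEdge G i j) j < utility g G j))

/-! ### The network formation process -/

/-- Agent `j` agrees that `i` establishes the edge `ij` (always, for non-consensual agents). -/
def Accepts (g : Game) (G : EdgeSet n) (i j : Fin n) : Prop :=
  match g.agentType with
  | .nonConsensual => True
  | .consensual => utility g G j ≤ utility g (addEdge G i j) j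

open Classical in
/-- One step of the process when the ordered pair `e = (i, j)` has been selected: agent `i` changes
her action on `ij` exactly if this does not decrease her utility (so indifferent agents switch),
where a new edge moreover needs the agreement of `j`. -/
noncomputable def step (g : Game) (G : EdgeSet n) (e : Fin n × Fin n) : EdgeSet n :=
  if (e.1, e.2) ∈ G then
    if utility g G e.1 ≤ utility g (delEdge G e.1 e.2) e.1 then delEdge G e.1 e.2 else G
  else
    if utility g G e.1 ≤ utility g (addEdge G e.1 e.2) e.1 ∧ Accepts g G e.1 e.2
    then addEdge G e.1 e.2 else G

/-- The network `G(t)`, started at `G₀`, when `x s` is the pair selected at time `s`. -/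
noncomputable def process (g : Game) (G₀ : EdgeSet n) (x : ℕ → Fin n × Fin n) : ℕ → EdgeSet n
  | 0 => G₀
  | t + 1 => step g (process g G₀ x t) (x t)

/-! ### Hierarchies -/

/-- A connected digraph all of whose strongly connected components are undirected. -/
def IsHierarchicalStructure (G : EdgeSet n) : Prop :=
  IsConnected G ∧ ∀ i, HasUndirectedComponent G i

/-- A hierarchical structure with one component per level in which every agent has a single edge
towards every agent of a higher level. -/
def IsSequentialHierarchy (G : EdgeSet n) : Prop :=
  IsHierarchicalStructure G ∧
  (∀ i j, level G i = level G j → component G i = component G j) ∧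
  (∀ i j, level G i < level G j → (i, j) ∈ G ∧ (j, i) ∉ G)

/-- The form of a network without critical edges that is an equilibrium for non-consensual agents:
a sequential hierarchy in which no agent gains from an edge to an agent one level below. -/
def NonConsensualForm (g : Game) (G : EdgeSet n) : Prop :=
  IsSequentialHierarchy G ∧
  ∀ i j, level G i = level G j + 1 →
    g.γ + g.c * ((((team G i).card : ℝ) +
          ((Finset.univ.filter fun m => level G m < level G i).card : ℝ)) /
        (((team G i).card : ℝ) * (((team G i).card : ℝ) + 1)))
      < g.H (level G i) - g.H (level G j)

/-- The form of a connected network without critical edges that is an equilibrium for consensual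
agents. -/
def ConsensualForm (g : Game) (G : EdgeSet n) : Prop :=
  IsHierarchicalStructure G ∧
  (∀ i j, j ∈ subordinates G i →
    let b := g.γ + g.c * (∑ p ∈ (subordinates G i).erase j,
        (((teamOver (addEdge G i j) i p).card : ℝ) - ((teamOver G i p).card : ℝ)) /
          (((teamOver G i p).card : ℝ) * ((teamOver (addEdge G i j) i p).card : ℝ)))
      + g.c / ((teamOver G i j).card : ℝ)
    0 < b ∧ b < g.H (level G i) - g.H (level G j)) ∧
  (∀ i j, level G j ≤ level G i → ¬ Reach G j i →
    g.H (level G i + 1) - g.H (level G j) < g.c)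

/-- The form of the limit network, according to the type of the agents. -/
def LimitForm (g : Game) (G : EdgeSet n) : Prop :=
  match g.agentType with
  | .nonConsensual => NonConsensualForm g G
  | .consensual => ConsensualForm g G

end HierNet

open HierNet

/-! The bound on `H` makes levels decide every choice. A new edge `ij` gives `i` a link and never
raises the management cost of `i`, so `i` gains if her level does not fall and loses if it does
(`utility_lt_addEdge_source`, `utility_addEdge_source_lt`); a target that rises in level gains too.
An edge can lower a level only by merging components.

At an equilibrium, single edges inside components would therefore be reciprocated, and if `j` is not
above `i` in level and cannot reach `i`, the edge `ij` would be formed, since it lifts `j`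
(`IsEquilibrium.reach_of_level_le`). So reachability is a total preorder, which gives connectedness.
A critical edge would let one of its endpoints gain a level by cutting it. The inequalities only
compare a cost of at most `γ + c n` with a jump of `H`.

For convergence, every non-equilibrium admits a step that lowers `potential`
(`exists_step_potential_lt`). As there are finitely many networks, concatenation yields one word of
selections leading all of them to equilibria (`exists_universal_word`). This word almost surely
occurs in the random sequence, and equilibria are absorbing. -/

namespace HierNet
variable {n : ℕ}

/-! ### Reachability -/

/-- `b` can be reached from `a`, but not conversely. -/
def Below (G : EdgeSet n) (a b : Fin n) : Prop := Reach G a b ∧ ¬ Reach G b a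

lemma Reach.trans {G : EdgeSet n} {a b c : Fin n} (h : Reach G a b) (h' : Reach G b c) :
    Reach G a c := Relation.ReflTransGen.trans h h'

lemma Reach.refl (G : EdgeSet n) (a : Fin n) : Reach G a a := Relation.ReflTransGen.refl

lemma Reach.single {G : EdgeSet n} {a b : Fin n} (h : (a, b) ∈ G) : Reach G a b :=
  Relation.ReflTransGen.single h

lemma Reach.mono {G G' : EdgeSet n} (h : G ⊆ G') {a b : Fin n} (hab : Reach G a b) :
    Reach G' a b := Relation.ReflTransGen.mono (fun _ _ he => h he) _ _ hab

lemma subset_addEdge (G : EdgeSet n) (i j : Fin n) : G ⊆ addEdge G i j :=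
  Finset.subset_insert _ _

lemma delEdge_subset (G : EdgeSet n) (i j : Fin n) : delEdge G i j ⊆ G :=
  Finset.erase_subset _ _

lemma addEdge_delEdge {G : EdgeSet n} {i j : Fin n} (h : (i, j) ∈ G) :
    addEdge (delEdge G i j) i j = G := Finset.insert_erase h

lemma notMem_delEdge (G : EdgeSet n) (i j : Fin n) : (i, j) ∉ delEdge G i j :=
  Finset.notMem_erase _ _

lemma reach_addEdge_iff {G : EdgeSet n} {i j x y : Fin n} :
    Reach (addEdge G i j) x y ↔ Reach G x y ∨ (Reach G x i ∧ Reach G j y) := by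
  constructor
  · intro h
    induction h with
    | refl => exact Or.inl (Reach.refl _ _)
    | tail _ hbc ih =>
      rcases Finset.mem_insert.1 hbc with he | he
      · obtain ⟨rfl, rfl⟩ := Prod.mk.inj he
        rcases ih with ih | ih
        · exact Or.inr ⟨ih, Reach.refl _ _⟩
        · exact Or.inr ⟨ih.1, Reach.refl _ _⟩
      · rcases ih with ih | ih
        · exact Or.inl (ih.trans (Reach.single he))
        · exact Or.inr ⟨ih.1, ih.2.trans (Reach.single he)⟩
  · rintro (h | ⟨h₁, h₂⟩)
    · exact h.mono (subset_addEdge _ _ _)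
    · exact ((h₁.mono (subset_addEdge _ _ _)).trans
        (Reach.single (Finset.mem_insert_self _ _))).trans (h₂.mono (subset_addEdge _ _ _))

lemma reach_addEdge_iff_of_reach {G : EdgeSet n} {i j x y : Fin n} (h : Reach G i j) :
    Reach (addEdge G i j) x y ↔ Reach G x y := by
  rw [reach_addEdge_iff]
  exact ⟨fun h' => h'.elim id fun h' => (h'.1.trans h).trans h'.2, Or.inl⟩

/-- Adding `ij` preserves the strict reachability order unless it merges components. -/
lemma Below.addEdge {G : EdgeSet n} {i j a b : Fin n} (hij : Reach G j i → Reach G i j)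
    (h : Below G a b) : Below (addEdge G i j) a b := by
  refine ⟨h.1.mono (subset_addEdge _ _ _), fun h' => ?_⟩
  rcases reach_addEdge_iff.1 h' with h' | ⟨h₁, h₂⟩
  · exact h.2 h'
  · exact h.2 ((h₁.trans (hij ((h₂.trans h.1).trans h₁))).trans h₂)

/-! ### Levels -/

lemma componentOf_eq_iff {G : EdgeSet n} {a b : Fin n} :
    componentOf G a = componentOf G b ↔ Reach G a b ∧ Reach G b a :=
  Quotient.eq (r := strongSetoid G)

lemma componentOf_out {G : EdgeSet n} (A : Component G) : componentOf G A.out = A :=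
  Quotient.out_eq A

lemma below_of_adj {G : EdgeSet n} {A B : Component G} {a b : Fin n}
    (hA : componentOf G a = A) (hB : componentOf G b = B) (h : (condensation G).Adj A B) :
    Below G a b := by
  obtain ⟨hne, a', b', ha', hb', he⟩ := h
  have h₁ := componentOf_eq_iff.1 (hA.trans ha'.symm)
  have h₂ := componentOf_eq_iff.1 (hb'.trans hB.symm)
  have hab : Reach G a b := (h₁.1.trans (Reach.single he)).trans h₂.1
  refine ⟨hab, fun hba => hne ?_⟩
  rw [← hA, ← hB]
  exact componentOf_eq_iff.2 ⟨hab, hba⟩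

open Classical in
/-- The number of agents from which `a` can be reached. -/
noncomputable def ancestorCount (G : EdgeSet n) (a : Fin n) : ℕ :=
  (Finset.univ.filter fun x => Reach G x a).card

/-- This count bounds path lengths in the condensation and serves as the measure for induction
towards its sources. -/
lemma ancestorCount_lt {G : EdgeSet n} {a b : Fin n} (h : Below G a b) :
    ancestorCount G a < ancestorCount G b := by
  classical
  refine Finset.card_lt_card ((Finset.ssubset_iff_of_subset fun x hx => ?_).2 ⟨b, ?_, ?_⟩)
  · simp only [Finset.mem_filter, Finset.mem_univ, true_and] at hx ⊢
    exact hx.trans h.1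
  · simpa using Reach.refl G b
  · simpa using h.2

lemma ancestorCount_pos (G : EdgeSet n) (a : Fin n) : 0 < ancestorCount G a := by
  classical
  exact Finset.card_pos.2 ⟨a, by simpa using Reach.refl G a⟩

lemma ancestorCount_le (G : EdgeSet n) (a : Fin n) : ancestorCount G a ≤ n := by
  classical
  exact (Finset.card_le_univ _).trans_eq (Fintype.card_fin n)

/-- The lengths of the paths of the condensation graph from a source to `A`. -/
def pathLengths (G : EdgeSet n) (A : Component G) : Set ℕ :=
  {m | ∃ p : RelSeries {e : Component G × Component G | (condensation G).Adj e.1 e.2},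
    (∀ w, ¬ (condensation G).Adj w p.head) ∧ p.last = A ∧ p.length = m}

lemma level_eq (G : EdgeSet n) (i : Fin n) : level G i = sSup (pathLengths G (componentOf G i)) :=
  rfl

lemma lt_of_mem_pathLengths {G : EdgeSet n} {A : Component G} {m : ℕ}
    (hm : m ∈ pathLengths G A) : m < n := by
  obtain ⟨p, -, -, rfl⟩ := hm
  -- The node at position `k` of a path has more than `k` ancestors.
  have key : ∀ k (hk : k < p.length + 1), k < ancestorCount G (p ⟨k, hk⟩).out := by
    intro k
    induction k with
    | zero => exact fun _ => ancestorCount_pos _ _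
    | succ k ih =>
      intro hk
      have h₁ := ih (by omega)
      have h₂ := ancestorCount_lt (below_of_adj (componentOf_out _) (componentOf_out _)
        (p.step ⟨k, by omega⟩))
      exact lt_of_le_of_lt (Nat.succ_le_of_lt h₁) h₂
  exact (key p.length (by omega)).trans_le (ancestorCount_le _ _)

lemma bddAbove_pathLengths (G : EdgeSet n) (A : Component G) : BddAbove (pathLengths G A) :=
  ⟨n, fun _ hm => (lt_of_mem_pathLengths hm).le⟩

lemma succ_mem_pathLengths {G : EdgeSet n} {A B : Component G} {m : ℕ}
    (hm : m ∈ pathLengths G A) (h : (condensation G).Adj A B) : m + 1 ∈ pathLengths G B := by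
  obtain ⟨p, hp, rfl, rfl⟩ := hm
  exact ⟨p.snoc B h, by simpa using hp, by simp, by simp⟩

lemma pathLengths_nonempty (G : EdgeSet n) (A : Component G) : (pathLengths G A).Nonempty := by
  induction hk : ancestorCount G A.out using Nat.strong_induction_on generalizing A with
  | _ k ih =>
    by_cases hA : ∃ B, (condensation G).Adj B A
    · obtain ⟨B, hB⟩ := hA
      obtain ⟨m, hm⟩ := ih _ (hk ▸ ancestorCount_lt
        (below_of_adj (componentOf_out _) (componentOf_out _) hB)) B rfl
      exact ⟨m + 1, succ_mem_pathLengths hm hB⟩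
    · push Not at hA
      exact ⟨0, RelSeries.singleton _ A, by simpa using hA, by simp, rfl⟩

/-- The supremum of an empty or unbounded set of naturals is 0 by default; nonemptiness and the
bound by `n` make it a true maximum. -/
lemma level_mem_pathLengths (G : EdgeSet n) (i : Fin n) :
    level G i ∈ pathLengths G (componentOf G i) :=
  Nat.sSup_mem (pathLengths_nonempty _ _) (bddAbove_pathLengths _ _)

lemma level_lt (G : EdgeSet n) (i : Fin n) : level G i < n :=
  lt_of_mem_pathLengths (level_mem_pathLengths G i)

lemma level_lt_or_reach {G : EdgeSet n} {a b : Fin n} (h : Reach G a b) :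
    level G a < level G b ∨ (level G a = level G b ∧ Reach G b a) := by
  induction h with
  | refl => exact Or.inr ⟨rfl, Reach.refl _ _⟩
  | @tail x y _ hxy ih =>
    by_cases he : componentOf G x = componentOf G y
    · have hl : level G x = level G y := by rw [level_eq, he, ← level_eq]
      rcases ih with ih | ih
      · exact Or.inl (hl ▸ ih)
      · exact Or.inr ⟨ih.1.trans hl, (componentOf_eq_iff.1 he).2.trans ih.2⟩
    · have hl : level G x < level G y :=
        Nat.lt_of_succ_le (le_csSup (bddAbove_pathLengths _ _)
          (succ_mem_pathLengths (level_mem_pathLengths G x) ⟨he, x, y, rfl, rfl, hxy⟩))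
      exact Or.inl (by omega)

lemma Below.level_lt {G : EdgeSet n} {a b : Fin n} (h : Below G a b) :
    level G a < level G b :=
  (level_lt_or_reach h.1).resolve_right fun h' => h.2 h'.2

lemma Reach.level_le {G : EdgeSet n} {a b : Fin n} (h : Reach G a b) :
    level G a ≤ level G b := by
  rcases level_lt_or_reach h with h | h <;> omega

lemma level_eq_of_component {G : EdgeSet n} {a b : Fin n} (h : Reach G a b) (h' : Reach G b a) :
    level G a = level G b := le_antisymm h.level_le h'.level_le

/-- The penultimate node of a longest path from a source to the component of `b` provides the
witness. -/
lemma exists_below {G : EdgeSet n} {b : Fin n} (h : level G b ≠ 0) :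
    ∃ a, Below G a b ∧ level G b = level G a + 1 := by
  obtain ⟨p, hp, hlast, hlen⟩ := level_mem_pathLengths G b
  have h0 : p.length ≠ 0 := hlen ▸ h
  have hadj : (condensation G).Adj p.eraseLast.last (componentOf G b) :=
    hlast ▸ p.eraseLast_last_rel_last h0
  refine ⟨p.eraseLast.last.out, below_of_adj (componentOf_out _) rfl hadj, ?_⟩
  have hbel := (below_of_adj (componentOf_out p.eraseLast.last) rfl hadj).level_lt
  have hle : p.length - 1 ≤ level G p.eraseLast.last.out :=
    le_csSup (bddAbove_pathLengths _ _)
      ⟨p.eraseLast, by simpa using hp, (componentOf_out _).symm, by simp⟩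
  omega

/-- Levels grow if the strict reachability order above a down-closed set of agents grows. -/
lemma level_le_level_of_below {G G' : EdgeSet n} (S : Fin n → Prop)
    (h : ∀ a b, S b → Below G a b → S a ∧ Below G' a b) {i : Fin n} (hi : S i) :
    level G i ≤ level G' i := by
  induction hk : level G i using Nat.strong_induction_on generalizing i with
  | _ k ih =>
    rcases Nat.eq_zero_or_pos k with rfl | hpos
    · exact Nat.zero_le _
    · obtain ⟨a, ha, hla⟩ := exists_below (b := i) (by omega : level G i ≠ 0)
      obtain ⟨hSa, ha'⟩ := h a i hi ha
      have h₁ := ih (level G a) (by omega) hSa rfl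
      have h₂ := ha'.level_lt
      omega

lemma level_congr {G G' : EdgeSet n} (h : ∀ a b, Reach G a b ↔ Reach G' a b) (i : Fin n) :
    level G i = level G' i :=
  le_antisymm
    (level_le_level_of_below (fun _ => True)
      (fun a b _ hab => ⟨trivial, (h a b).1 hab.1, fun h' => hab.2 ((h b a).2 h')⟩) trivial)
    (level_le_level_of_below (fun _ => True)
      (fun a b _ hab => ⟨trivial, (h a b).2 hab.1, fun h' => hab.2 ((h b a).1 h')⟩) trivial)

lemma level_le_level_addEdge {G : EdgeSet n} {i j : Fin n} (hij : Reach G j i → Reach G i j)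
    (x : Fin n) : level G x ≤ level (addEdge G i j) x :=
  level_le_level_of_below (fun _ => True) (fun _ _ _ hab => ⟨trivial, hab.addEdge hij⟩) trivial

/-- If any two agents are comparable, then merging components lowers the level. -/
lemma level_addEdge_lt_of_total {G : EdgeSet n} (htot : ∀ a b, Reach G a b ∨ Reach G b a)
    {i j : Fin n} (h : Below G j i) : level (addEdge G i j) i < level G i := by
  -- By totality, every strict relation of the enlarged network already holds in `G`, so this level
  -- cannot rise.
  have h₁ : level (addEdge G i j) j ≤ level G j :=
    level_le_level_of_below (fun _ => True) (fun a b _ hab =>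
      have hba : ¬ Reach G b a := fun h' => hab.2 (h'.mono (subset_addEdge _ _ _))
      ⟨trivial, (htot a b).resolve_right hba, hba⟩) trivial
  have h₂ : level (addEdge G i j) i = level (addEdge G i j) j :=
    level_eq_of_component (Reach.single (Finset.mem_insert_self _ _))
      (h.1.mono (subset_addEdge _ _ _))
  have h₃ := h.level_lt
  omega

/-- Putting `ij` back lowers the level of `i`, so it must merge components: otherwise it preserves
the strict order, or even all of reachability. -/
lemma reach_and_not_reach_of_level_delEdge_lt {G : EdgeSet n} {i j : Fin n} (hG : (i, j) ∈ G)
    (h : level G i < level (delEdge G i j) i) :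
    Reach G j i ∧ ¬ Reach (delEdge G i j) i j := by
  have hadd := addEdge_delEdge hG
  constructor
  · by_contra hji
    have := level_le_level_addEdge (G := delEdge G i j) (i := i) (j := j)
      (fun h' => absurd (h'.mono (delEdge_subset _ _ _)) hji) i
    rw [hadd] at this
    omega
  · intro hij
    have := level_congr (G := addEdge (delEdge G i j) i j) (G' := delEdge G i j)
      (fun a b => reach_addEdge_iff_of_reach hij) i
    rw [hadd] at this
    omega

/-! ### Utilities -/

/-- The number of subordinates of `i`, weighted with the sizes of the teams over them. -/
noncomputable def managementLoad (G : EdgeSet n) (i : Fin n) : ℝ :=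
  ∑ k ∈ subordinates G i, 1 / ((teamOver G i k).card : ℝ)

lemma utility_eq (g : Game) (G : EdgeSet n) (i : Fin n) :
    utility g G i = ((outNbrs G i).card : ℝ) * g.γ + g.H (level G i) - g.c * managementLoad G i :=
  rfl

lemma one_le_card_teamOver (G : EdgeSet n) (i k : Fin n) : (1 : ℝ) ≤ (teamOver G i k).card := by
  exact_mod_cast Finset.card_pos.2 ⟨i, Finset.mem_insert_self _ _⟩

lemma teamOver_mono {G G' : EdgeSet n} (h : G ⊆ G') (i k : Fin n) :
    teamOver G i k ⊆ teamOver G' i k :=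
  Finset.insert_subset_insert _
    (Finset.monotone_filter_right _ fun _ _ hx => ⟨h hx.1, h hx.2.1, h hx.2.2⟩)

lemma managementLoad_nonneg (G : EdgeSet n) (i : Fin n) : 0 ≤ managementLoad G i :=
  Finset.sum_nonneg fun _ _ => by positivity

lemma managementLoad_le (G : EdgeSet n) (i : Fin n) : managementLoad G i ≤ n := by
  calc managementLoad G i ≤ ∑ _k ∈ subordinates G i, (1 : ℝ) :=
        Finset.sum_le_sum fun k _ => div_le_one_of_le₀ (one_le_card_teamOver G i k) (by positivity)
    _ = ((subordinates G i).card : ℝ) := by simp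
    _ ≤ n := by exact_mod_cast (Finset.card_le_univ _).trans_eq (Fintype.card_fin n)

lemma managementLoad_anti {G G' : EdgeSet n} (h : G ⊆ G') {i : Fin n}
    (hs : subordinates G' i ⊆ subordinates G i) : managementLoad G' i ≤ managementLoad G i := by
  calc managementLoad G' i ≤ ∑ k ∈ subordinates G' i, 1 / ((teamOver G i k).card : ℝ) :=
        Finset.sum_le_sum fun k _ => one_div_le_one_div_of_le
          (lt_of_lt_of_le one_pos (one_le_card_teamOver G i k))
          (by exact_mod_cast Finset.card_le_card (teamOver_mono h i k))
    _ ≤ _ := Finset.sum_le_sum_of_subset_of_nonneg hs fun _ _ _ => by positivity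

lemma managementLoad_addEdge_source {G : EdgeSet n} {i j : Fin n} (hij : i ≠ j) :
    managementLoad (addEdge G i j) i ≤ managementLoad G i := by
  refine managementLoad_anti (subset_addEdge _ _ _) fun k hk => ?_
  simp only [subordinates, addEdge, Finset.mem_filter, Finset.mem_univ, true_and,
    Finset.mem_insert, Prod.mk.injEq, not_or] at hk ⊢
  exact ⟨hk.1.resolve_left fun h => hij h.2, hk.2.2⟩

/-- Because `ji` is present, `i` does not become a subordinate of `j`. -/
lemma managementLoad_addEdge_target {G : EdgeSet n} {i j : Fin n} (hji : (j, i) ∈ G) :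
    managementLoad (addEdge G i j) j ≤ managementLoad G j := by
  refine managementLoad_anti (subset_addEdge _ _ _) fun k hk => ?_
  simp only [subordinates, addEdge, Finset.mem_filter, Finset.mem_univ, true_and,
    Finset.mem_insert, Prod.mk.injEq, not_or] at hk ⊢
  refine ⟨hk.1.resolve_left fun h => hk.2.2 ?_, hk.2.2⟩
  rw [h.1]
  exact hji

lemma card_outNbrs_addEdge {G : EdgeSet n} {i j : Fin n} (h : (i, j) ∉ G) :
    (outNbrs (addEdge G i j) i).card = (outNbrs G i).card + 1 := by
  have : outNbrs (addEdge G i j) i = insert j (outNbrs G i) := by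
    ext x
    simp [outNbrs, addEdge]
  rw [this, Finset.card_insert_of_notMem (by simpa [outNbrs] using h)]

lemma outNbrs_addEdge_of_ne {G : EdgeSet n} {i j k : Fin n} (h : k ≠ i) :
    outNbrs (addEdge G i j) k = outNbrs G k := by
  ext x
  simp [outNbrs, addEdge, h]

/-- One more level is worth more than one link and the cost of all possible subordinates. -/
def LevelsDominate (g : Game) (n : ℕ) : Prop :=
  ∀ l : ℕ, l ≤ n - 1 → g.γ + g.c * (n : ℝ) < g.H (l + 1) - g.H l

lemma LevelsDominate.lt_sub {g : Game} (hH : LevelsDominate g n) {l m : ℕ} (hl : l < n)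
    (hlm : l < m) : g.γ + g.c * (n : ℝ) < g.H m - g.H l := by
  have h₁ := hH l (by omega)
  have h₂ : g.H (l + 1) ≤ g.H m := g.H_strictMono.monotone hlm
  linarith

/-- A new edge that does not lower the level of its source is profitable for the source. -/
lemma utility_lt_addEdge_source (g : Game) {G : EdgeSet n} {i j : Fin n} (hij : i ≠ j)
    (hG : (i, j) ∉ G) (hl : level G i ≤ level (addEdge G i j) i) :
    utility g G i < utility g (addEdge G i j) i := by
  rw [utility_eq, utility_eq, card_outNbrs_addEdge hG]
  have h₁ := g.H_strictMono.monotone hl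
  have h₂ := mul_le_mul_of_nonneg_left (managementLoad_addEdge_source (G := G) hij) g.c_pos.le
  have h₃ := g.γ_pos
  push_cast
  linarith

/-- A new edge that lowers the level of its source is harmful for the source. -/
lemma utility_addEdge_source_lt {g : Game} (hH : LevelsDominate g n) {G : EdgeSet n}
    {i j : Fin n} (hG : (i, j) ∉ G) (hl : level (addEdge G i j) i < level G i) :
    utility g (addEdge G i j) i < utility g G i := by
  rw [utility_eq, utility_eq, card_outNbrs_addEdge hG]
  have h₁ := hH.lt_sub (level_lt _ _) hl
  have h₂ := mul_le_mul_of_nonneg_left (managementLoad_le G i) g.c_pos.le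
  have h₃ := mul_nonneg g.c_pos.le (managementLoad_nonneg (addEdge G i j) i)
  push_cast
  linarith

/-- A new edge that raises the level of its target is profitable for the target. -/
lemma utility_lt_addEdge_target {g : Game} (hH : LevelsDominate g n) {G : EdgeSet n}
    {i j : Fin n} (hij : i ≠ j) (hl : level G j < level (addEdge G i j) j) :
    utility g G j < utility g (addEdge G i j) j := by
  rw [utility_eq, utility_eq, outNbrs_addEdge_of_ne hij.symm]
  have h₁ := hH.lt_sub (level_lt _ _) hl
  have h₂ := mul_le_mul_of_nonneg_left (managementLoad_le (addEdge G i j) j) g.c_pos.le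
  have h₃ := mul_nonneg g.c_pos.le (managementLoad_nonneg G j)
  have h₄ := g.γ_pos
  linarith

lemma utility_le_addEdge_target (g : Game) {G : EdgeSet n} {i j : Fin n} (hij : i ≠ j)
    (hji : (j, i) ∈ G) (hl : level G j ≤ level (addEdge G i j) j) :
    utility g G j ≤ utility g (addEdge G i j) j := by
  rw [utility_eq, utility_eq, outNbrs_addEdge_of_ne hij.symm]
  have h₁ := g.H_strictMono.monotone hl
  have h₂ := mul_le_mul_of_nonneg_left (managementLoad_addEdge_target hji) g.c_pos.le
  linarith

lemma level_delEdge_lt_iff {g : Game} (hH : LevelsDominate g n) {G : EdgeSet n} {i j : Fin n}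
    (hij : i ≠ j) (hG : (i, j) ∈ G) :
    level G i < level (delEdge G i j) i ↔ utility g G i ≤ utility g (delEdge G i j) i := by
  have hadd := addEdge_delEdge hG
  constructor
  · intro h
    have := utility_addEdge_source_lt hH (notMem_delEdge G i j) (by rwa [hadd])
    rw [hadd] at this
    exact this.le
  · intro h
    by_contra hl
    have := utility_lt_addEdge_source g hij (notMem_delEdge G i j) (by rw [hadd]; omega)
    rw [hadd] at this
    linarith

/-- The edge merges nothing, so `i` keeps at least her level, and `j` ends up strictly above `i`. -/
lemma level_lt_addEdge_target {G : EdgeSet n} {i j : Fin n} (hji : ¬ Reach G j i)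
    (hl : level G j ≤ level G i) : level G j < level (addEdge G i j) j := by
  have h₁ := level_le_level_addEdge (G := G) (i := i) (j := j) (fun h => absurd h hji) i
  have h₂ : Below (addEdge G i j) i j := by
    refine ⟨Reach.single (Finset.mem_insert_self _ _), fun h => ?_⟩
    rcases reach_addEdge_iff.1 h with h | h
    · exact hji h
    · exact hji h.1
  have h₃ := h₂.level_lt
  omega

/-! ### Equilibria -/

lemma accepts_of_utility_le {g : Game} {G : EdgeSet n} {i j : Fin n}
    (h : utility g G j ≤ utility g (addEdge G i j) j) : Accepts g G i j := by
  unfold Accepts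
  split
  · trivial
  · exact h

lemma IsEquilibrium.delEdge_lt {g : Game} {G : EdgeSet n} (h : IsEquilibrium g G) {i j : Fin n}
    (hij : i ≠ j) (hG : (i, j) ∈ G) : utility g (delEdge G i j) i < utility g G i :=
  (h i j hij).1 hG

/-- This is the form that matches `step`: no selected pair of different agents leads to a change. -/
lemma isEquilibrium_iff {g : Game} {G : EdgeSet n} :
    IsEquilibrium g G ↔ ∀ i j : Fin n, i ≠ j →
      ((i, j) ∈ G → ¬ utility g G i ≤ utility g (delEdge G i j) i) ∧
      ((i, j) ∉ G → ¬ (utility g G i ≤ utility g (addEdge G i j) i ∧ Accepts g G i j)) := by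
  unfold IsEquilibrium Accepts
  refine forall_congr' fun i => forall_congr' fun j => forall_congr' fun _ => ?_
  refine and_congr (by simp only [not_le]) (forall_congr' fun _ => ?_)
  split
  · simp
  · rw [not_and_or, not_le, not_le]
    constructor
    · rintro (h | h)
      · exact Or.inl h
      · exact Or.inr h.2
    · rintro (h | h)
      · exact Or.inl h
      · exact (lt_or_ge _ _).imp_right fun h' => ⟨h', h⟩

lemma IsEquilibrium.step_eq {g : Game} {G : EdgeSet n} (h : IsEquilibrium g G)
    {e : Fin n × Fin n} (he : e.1 ≠ e.2) : step g G e = G := by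
  have h' := isEquilibrium_iff.1 h e.1 e.2 he
  unfold step
  split_ifs with h₁ h₂ h₂
  · exact absurd h₂ (h'.1 h₁)
  · rfl
  · exact absurd h₂ (h'.2 h₁)
  · rfl

/-- Reciprocating a single edge inside a component changes no reachability; the source gains a link
and the target acquires no subordinate, so both agree. -/
lemma IsEquilibrium.hasUndirectedComponent {g : Game} {G : EdgeSet n} (hN : IsNetwork G)
    (h : IsEquilibrium g G) (i : Fin n) : HasUndirectedComponent G i := by
  intro a ha b hb hab
  by_contra hba
  have hne : b ≠ a := fun h' => hN _ hab h'.symm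
  have hr : Reach G b a := hb.2.trans ha.1
  have hl := level_le_level_addEdge (G := G) (i := b) (j := a) (fun _ => hr)
  exact (isEquilibrium_iff.1 h b a hne).2 hba
    ⟨(utility_lt_addEdge_source g hne hba (hl b)).le,
      accepts_of_utility_le (utility_le_addEdge_target g hne hab (hl a))⟩

lemma IsEquilibrium.reach_of_level_le {g : Game} (hH : LevelsDominate g n) {G : EdgeSet n}
    (h : IsEquilibrium g G) {i j : Fin n} (hl : level G j ≤ level G i) : Reach G j i := by
  by_contra hji
  have hij : i ≠ j := fun h' => hji (h' ▸ Reach.refl _ _)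
  have hG : (i, j) ∉ G := fun h' =>
    (level_lt_or_reach (Reach.single h')).elim (fun h' => by omega) fun h' => hji h'.2
  exact (isEquilibrium_iff.1 h i j hij).2 hG
    ⟨(utility_lt_addEdge_source g hij hG (level_le_level_addEdge (fun h' => absurd h' hji) i)).le,
      accepts_of_utility_le (utility_lt_addEdge_target hH hij (level_lt_addEdge_target hji hl)).le⟩

lemma IsEquilibrium.isConnected {g : Game} (hH : LevelsDominate g n) {G : EdgeSet n}
    (h : IsEquilibrium g G) : IsConnected G := by
  have key : ∀ {a b : Fin n}, Reach G a b →
      Relation.ReflTransGen (fun a b => (a, b) ∈ G ∨ (b, a) ∈ G) a b :=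
    fun hab => Relation.ReflTransGen.mono (fun _ _ he => Or.inl he) _ _ hab
  intro i j
  rcases le_total (level G i) (level G j) with hl | hl
  · exact key (h.reach_of_level_le hH hl)
  · have : Std.Symm fun a b => (a, b) ∈ G ∨ (b, a) ∈ G := ⟨fun _ _ he => he.symm⟩
    exact Std.Symm.symm _ _ (key (h.reach_of_level_le hH hl))

/-! ### Critical edges -/

/-- Paths within an undirected component can be reversed. -/
lemma reach_reverse {G : EdgeSet n} {i j : Fin n} (hU : HasUndirectedComponent G i)
    (hij : Reach G i j) {x : Fin n} (hx : Reach (delEdge G j i) j x) (hxi : Reach G x i) :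
    Reach (delEdge G i j) x j := by
  induction hx with
  | refl => exact Reach.refl _ _
  | @tail y z hjy hyz ih =>
    have hyz' := Finset.mem_erase.1 hyz
    have hjy' : Reach G j y := Reach.mono (delEdge_subset _ _ _) hjy
    have hyi : Reach G y i := (Reach.single hyz'.2).trans hxi
    -- The edge reverses because `y` and `z` lie in the component of `i`; as the path avoids `ji`,
    -- its reversal avoids `ij`.
    have hzy : (z, y) ∈ delEdge G i j := by
      refine Finset.mem_erase.2 ⟨fun h => hyz'.1 ?_, hU y ⟨hij.trans hjy', hyi⟩ z
        ⟨(hij.trans hjy').trans (Reach.single hyz'.2), hxi⟩ hyz'.2⟩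
      obtain ⟨rfl, rfl⟩ := Prod.mk.inj h
      rfl
    exact (Reach.single hzy).trans (ih hyi)

lemma reach_delEdge_of_not_reach {G : EdgeSet n} {i j a b : Fin n} (hG : (i, j) ∈ G)
    (hab : Reach G a b) (hib : ¬ Reach G i b) : Reach (delEdge G i j) a b := by
  rw [← addEdge_delEdge hG, reach_addEdge_iff] at hab
  refine hab.resolve_right fun h => hib ?_
  exact (Reach.single hG).trans (h.2.mono (delEdge_subset _ _ _))

/-- Stop the path at its first use of `ij` or `ji`. -/
lemma reach_endpoint {G : EdgeSet n} {i j q x : Fin n} (h : Reach G q x) :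
    Reach (delEdge (delEdge G i j) j i) q x ∨
      Reach (delEdge (delEdge G i j) j i) q i ∨ Reach (delEdge (delEdge G i j) j i) q j := by
  induction h with
  | refl => exact Or.inl (Reach.refl _ _)
  | @tail y z _ hyz ih =>
    rcases ih with ih | ih
    · by_cases h₁ : (y, z) = (i, j)
      · obtain ⟨rfl, rfl⟩ := Prod.mk.inj h₁
        exact Or.inr (Or.inl ih)
      · by_cases h₂ : (y, z) = (j, i)
        · obtain ⟨rfl, rfl⟩ := Prod.mk.inj h₂
          exact Or.inr (Or.inr ih)
        · exact Or.inl (ih.trans (Reach.single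
            (Finset.mem_erase.2 ⟨h₂, Finset.mem_erase.2 ⟨h₁, hyz⟩⟩)))
    · exact Or.inr ih

/-- If the component of `i, j` is entered at the side of `j`, then `i` gains a level by deleting
the bridge `ij`. -/
lemma level_lt_level_delEdge {G : EdgeSet n} {i j q : Fin n} (hij : (i, j) ∈ G)
    (hji : (j, i) ∈ G) (hcut : ¬ Reach (delEdge G i j) i j) (hne : i ≠ j) (hq : Below G q i)
    (hlq : level G i = level G q + 1) (hqj : Reach (delEdge G i j) q j) :
    level G i < level (delEdge G i j) i := by
  -- Paths ending at `q` or below cannot use `ij`, since `q` is strictly below `i`. After the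
  -- deletion `q`, `j`, `i` is a strict chain, putting `i` two levels above `q` instead of one.
  have h₁ : level G q ≤ level (delEdge G i j) q :=
    level_le_level_of_below (fun x => Reach G x q) (fun a b hb hab =>
      ⟨hab.1.trans hb,
        reach_delEdge_of_not_reach hij hab.1 fun h => hq.2 (h.trans hb),
        fun h => hab.2 (h.mono (delEdge_subset _ _ _))⟩) (Reach.refl _ _)
  have h₂ : Below (delEdge G i j) q j :=
    ⟨hqj, fun h => hq.2 ((Reach.single hij).trans (h.mono (delEdge_subset _ _ _)))⟩
  have h₃ : Below (delEdge G i j) j i :=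
    ⟨Reach.single (Finset.mem_erase.2 ⟨by simp [hne], hji⟩), hcut⟩
  have h₄ := h₂.level_lt
  have h₅ := h₃.level_lt
  omega

/-- A critical edge is a bridge in both directions. A path from an agent one level below reaches one
endpoint without the bridge; the other endpoint then gains a level by deleting her half of it. At
level 0, being cut off below `j` already lifts `i`. -/
lemma IsEquilibrium.not_isCritical {g : Game} (hH : LevelsDominate g n) {G : EdgeSet n}
    (hN : IsNetwork G) (h : IsEquilibrium g G) (i j : Fin n) : ¬ IsCritical G i j := by
  rintro ⟨hU, hij, hji, hcomp⟩
  have hne : i ≠ j := hN _ hij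
  have hcut : ¬ Reach (delEdge G i j) i j := by
    intro hr
    refine hcomp (Set.ext fun x => ?_)
    simp only [component, Set.mem_ofPred_eq]
    conv_lhs => rw [← addEdge_delEdge hij]
    rw [reach_addEdge_iff_of_reach hr, reach_addEdge_iff_of_reach hr]
  have hcut' : ¬ Reach (delEdge G j i) j i := fun hr =>
    hcut (reach_reverse hU (Reach.single hij) hr (Reach.refl _ _))
  have hi : ¬ level G i < level (delEdge G i j) i := fun hl =>
    ((level_delEdge_lt_iff hH hne hij).1 hl).not_gt (h.delEdge_lt hne hij)
  have hj : ¬ level G j < level (delEdge G j i) j := fun hl =>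
    ((level_delEdge_lt_iff hH hne.symm hji).1 hl).not_gt (h.delEdge_lt hne.symm hji)
  by_cases h0 : level G i = 0
  · have : Below (delEdge G i j) j i :=
      ⟨Reach.single (Finset.mem_erase.2 ⟨by simp [hne], hji⟩), hcut⟩
    have := this.level_lt
    omega
  · obtain ⟨q, hq, hlq⟩ := exists_below h0
    have hd : delEdge (delEdge G i j) j i ⊆ delEdge G i j := delEdge_subset _ _ _
    have hd' : delEdge (delEdge G i j) j i ⊆ delEdge G j i := by
      rw [delEdge, delEdge, Finset.erase_right_comm]
      exact delEdge_subset _ _ _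
    have hlev : level G i = level G j :=
      level_eq_of_component (Reach.single hij) (Reach.single hji)
    have hqj : Below G q j :=
      ⟨hq.1.trans (Reach.single hij), fun h' => hq.2 ((Reach.single hij).trans h')⟩
    have key : Reach (delEdge (delEdge G i j) j i) q i ∨
        Reach (delEdge (delEdge G i j) j i) q j := by
      rcases reach_endpoint (i := i) (j := j) hq.1 with h' | h'
      · exact Or.inl h'
      · exact h'
    rcases key with hr | hr
    · exact hj (level_lt_level_delEdge hji hij hcut' hne.symm hqj (by omega) (hr.mono hd'))
    · exact hi (level_lt_level_delEdge hij hji hcut hne hq hlq (hr.mono hd))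

/-! ### The form of the equilibria -/

lemma IsEquilibrium.isHierarchicalStructure {g : Game} (hH : LevelsDominate g n)
    {G : EdgeSet n} (hN : IsNetwork G) (h : IsEquilibrium g G) : IsHierarchicalStructure G :=
  ⟨h.isConnected hH, h.hasUndirectedComponent hN⟩

lemma IsEquilibrium.nonConsensualForm {g : Game} (hH : LevelsDominate g n) {G : EdgeSet n}
    (hN : IsNetwork G) (h : IsEquilibrium g G) (hA : g.agentType = .nonConsensual) :
    NonConsensualForm g G := by
  refine ⟨⟨h.isHierarchicalStructure hH hN, fun i j hl => ?_, fun i j hl => ?_⟩, fun i j hl => ?_⟩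
  · have h₁ := h.reach_of_level_le hH hl.le
    have h₂ := h.reach_of_level_le hH hl.ge
    ext x
    exact ⟨fun hx => ⟨h₂.trans hx.1, hx.2.trans h₁⟩, fun hx => ⟨h₁.trans hx.1, hx.2.trans h₂⟩⟩
  · have hji : ¬ Reach G j i := fun h' => (h'.level_le).not_gt hl
    refine ⟨?_, fun h' => hji (Reach.single h')⟩
    by_contra hG
    have hij : i ≠ j := fun h' => hl.ne (h' ▸ rfl)
    exact (isEquilibrium_iff.1 h i j hij).2 hG
      ⟨(utility_lt_addEdge_source g hij hG
        (level_le_level_addEdge (fun h' => absurd h' hji) i)).le, by simp [Accepts, hA]⟩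
  · have hT : (1 : ℝ) ≤ (team G i).card := by
      have hi : i ∈ team G i := by simp [team, teamOver]
      exact_mod_cast Finset.card_pos.2 ⟨i, hi⟩
    set m := Finset.univ.filter fun m => level G m < level G i
    have hm : (m.card : ℝ) + 1 ≤ n := by
      have : m.card < n := by
        simpa using Finset.card_lt_univ_of_notMem (s := m) (x := i) (by simp [m])
      exact_mod_cast this
    have hd := hH.lt_sub (level_lt G j) (by omega : level G j < level G i)
    have hq : (((team G i).card : ℝ) + (m.card : ℝ)) /
        (((team G i).card : ℝ) * (((team G i).card : ℝ) + 1)) ≤ n := by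
      have hn : (0 : ℝ) ≤ (n : ℝ) - 1 := by linarith [(Nat.cast_nonneg m.card : (0 : ℝ) ≤ _)]
      have hs : (0 : ℝ) ≤ (n : ℝ) * (team G i).card * (team G i).card := by positivity
      rw [div_le_iff₀ (by positivity)]
      -- With `T` the team size, `(n - 1)(T - 1) ≥ 0` gives `(n - 1) T ≥ n - 1 ≥ |m|`, hence `n T (T
      -- + 1) ≥ T + |m|`.
      linarith [mul_nonneg hn (sub_nonneg.2 hT)]
    linarith [mul_le_mul_of_nonneg_left hq g.c_pos.le]

/-- The sum has at most `n - 1` terms, each in `[0, 1]`, and the last summand is at most `c`, so the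
bound stays within `γ + c n`. The final clause is vacuous, since reachability follows from the order
of levels. -/
lemma IsEquilibrium.consensualForm {g : Game} (hH : LevelsDominate g n) {G : EdgeSet n}
    (hN : IsNetwork G) (h : IsEquilibrium g G) : ConsensualForm g G := by
  have hS := h.isHierarchicalStructure hH hN
  refine ⟨hS, fun i j hj => ?_, fun i j hl hji => absurd (h.reach_of_level_le hH hl) hji⟩
  have hj' : (j, i) ∈ G ∧ (i, j) ∉ G := by simpa [subordinates] using hj
  have hlev : level G j < level G i :=
    (level_lt_or_reach (Reach.single hj'.1)).resolve_right fun h' =>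
      hj'.2 (hS.2 i j ⟨h'.2, Reach.single hj'.1⟩ i ⟨Reach.refl _ _, Reach.refl _ _⟩ hj'.1)
  have hsum : ∀ p, 0 ≤ (((teamOver (addEdge G i j) i p).card : ℝ) - ((teamOver G i p).card : ℝ)) /
        (((teamOver G i p).card : ℝ) * ((teamOver (addEdge G i j) i p).card : ℝ)) ∧
      (((teamOver (addEdge G i j) i p).card : ℝ) - ((teamOver G i p).card : ℝ)) /
        (((teamOver G i p).card : ℝ) * ((teamOver (addEdge G i j) i p).card : ℝ)) ≤ 1 := by
    intro p
    have h₁ := one_le_card_teamOver G i p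
    have h₂ : ((teamOver G i p).card : ℝ) ≤ (teamOver (addEdge G i j) i p).card := by
      exact_mod_cast Finset.card_le_card (teamOver_mono (subset_addEdge _ _ _) i p)
    refine ⟨div_nonneg (by linarith) (by positivity), ?_⟩
    rw [div_le_one (by nlinarith)]
    nlinarith
  have hs₀ := Finset.sum_nonneg fun p (_ : p ∈ (subordinates G i).erase j) => (hsum p).1
  have hs₁ := Finset.sum_le_sum fun p (_ : p ∈ (subordinates G i).erase j) => (hsum p).2
  have hcard : (((subordinates G i).erase j).card : ℝ) + 1 ≤ n := by
    have : ((subordinates G i).erase j).card + 1 ≤ n := by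
      rw [Finset.card_erase_add_one hj]
      exact (Finset.card_le_univ _).trans_eq (Fintype.card_fin n)
    exact_mod_cast this
  simp only [Finset.sum_const, nsmul_eq_mul, mul_one] at hs₁
  have ht₁ := one_le_card_teamOver G i j
  have ht₀ : g.c / ((teamOver G i j).card : ℝ) ≤ g.c := div_le_self g.c_pos.le ht₁
  have ht : 0 < g.c / ((teamOver G i j).card : ℝ) := div_pos g.c_pos (by linarith)
  have hd := hH.lt_sub (level_lt G j) hlev
  have hγ := g.γ_pos
  have hs₂ := mul_nonneg g.c_pos.le hs₀
  have hs₃ := mul_le_mul_of_nonneg_left (hs₁.trans (by linarith : _ ≤ (n : ℝ) - 1)) g.c_pos.le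
  refine ⟨by linarith, by linarith⟩

lemma IsEquilibrium.limitForm {g : Game} (hH : LevelsDominate g n) {G : EdgeSet n}
    (hN : IsNetwork G) (h : IsEquilibrium g G) : LimitForm g G := by
  unfold LimitForm
  split
  · exact h.nonConsensualForm hH hN ‹_›
  · exact h.consensualForm hH hN

/-! ### Progress towards equilibria -/

open Classical in
/-- The pairs of strongly connected agents. -/
noncomputable def strongPairs (G : EdgeSet n) : Finset (Fin n × Fin n) :=
  Finset.univ.filter fun p => Reach G p.1 p.2 ∧ Reach G p.2 p.1

lemma mem_strongPairs {G : EdgeSet n} {p : Fin n × Fin n} :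
    p ∈ strongPairs G ↔ Reach G p.1 p.2 ∧ Reach G p.2 p.1 := by
  simp [strongPairs]

/-- The lexicographic potential given by the number of strongly connected pairs and the number of
missing edges. -/
noncomputable def potential (G : EdgeSet n) : ℕ :=
  (strongPairs G).card * (n * n + 1) + (n * n - G.card)

lemma card_le_sq (G : EdgeSet n) : G.card ≤ n * n :=
  (Finset.card_le_univ _).trans_eq (by simp)

lemma potential_addEdge_lt {G : EdgeSet n} {i j : Fin n} (hG : (i, j) ∉ G)
    (hij : Reach G j i → Reach G i j) : potential (addEdge G i j) < potential G := by
  have hs : strongPairs (addEdge G i j) ⊆ strongPairs G := by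
    rintro ⟨x, y⟩ hp
    rw [mem_strongPairs, reach_addEdge_iff, reach_addEdge_iff] at hp
    rw [mem_strongPairs]
    obtain ⟨h₁ | h₁, h₂ | h₂⟩ := hp
    · exact ⟨h₁, h₂⟩
    · exact ⟨h₁, (h₂.1.trans (hij ((h₂.2.trans h₁).trans h₂.1))).trans h₂.2⟩
    · exact ⟨(h₁.1.trans (hij ((h₁.2.trans h₂).trans h₁.1))).trans h₁.2, h₂⟩
    · have h := hij (h₁.2.trans h₂.1)
      exact ⟨(h₁.1.trans h).trans h₁.2, (h₂.1.trans h).trans h₂.2⟩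
  have h₁ := Nat.mul_le_mul_right (n * n + 1) (Finset.card_le_card hs)
  have h₂ : (addEdge G i j).card = G.card + 1 := Finset.card_insert_of_notMem hG
  -- Subtraction in `potential` is truncated; this ensures that the count of missing edges really
  -- drops.
  have h₃ := card_le_sq (addEdge G i j)
  unfold potential
  omega

/-- Losing one strong pair is worth `n * n + 1`, more than any increase in missing edges. -/
lemma potential_delEdge_lt {G : EdgeSet n} {i j : Fin n} (hG : (i, j) ∈ G)
    (hji : Reach G j i) (hij : ¬ Reach (delEdge G i j) i j) :
    potential (delEdge G i j) < potential G := by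
  have hs : strongPairs (delEdge G i j) ⊂ strongPairs G := by
    refine (Finset.ssubset_iff_of_subset fun p hp => ?_).2 ⟨(i, j), ?_, ?_⟩
    · rw [mem_strongPairs] at hp ⊢
      exact ⟨hp.1.mono (delEdge_subset _ _ _), hp.2.mono (delEdge_subset _ _ _)⟩
    · exact mem_strongPairs.2 ⟨Reach.single hG, hji⟩
    · exact fun h => hij (mem_strongPairs.1 h).1
  have h₁ := Nat.mul_le_mul_right (n * n + 1) (Nat.succ_le_of_lt (Finset.card_lt_card hs))
  rw [Nat.succ_mul] at h₁
  unfold potential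
  omega

lemma step_of_mem {g : Game} {G : EdgeSet n} {i j : Fin n} (hG : (i, j) ∈ G)
    (h : utility g G i ≤ utility g (delEdge G i j) i) : step g G (i, j) = delEdge G i j := by
  simp [step, hG, h]

lemma step_of_notMem {g : Game} {G : EdgeSet n} {i j : Fin n} (hG : (i, j) ∉ G)
    (h : utility g G i ≤ utility g (addEdge G i j) i) (h' : Accepts g G i j) :
    step g G (i, j) = addEdge G i j := by
  simp [step, hG, h, h']

/-- Incomparable agents can be linked. -/
lemma exists_step_of_incomparable {g : Game} (hH : LevelsDominate g n) {G : EdgeSet n}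
    {a b : Fin n} (hab : ¬ Reach G a b) (hba : ¬ Reach G b a) :
    ∃ e : Fin n × Fin n, e.1 ≠ e.2 ∧ potential (step g G e) < potential G := by
  -- The agent of higher level is the source, so that the target is lifted and accepts.
  wlog hl : level G b ≤ level G a generalizing a b
  · exact this hba hab (le_of_not_ge hl)
  have hne : a ≠ b := fun h => hab (h ▸ Reach.refl _ _)
  have hG : (a, b) ∉ G := fun h => hab (Reach.single h)
  refine ⟨(a, b), hne, ?_⟩
  rw [step_of_notMem hG
    (utility_lt_addEdge_source g hne hG (level_le_level_addEdge (fun h' => absurd h' hba) a)).le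
    (accepts_of_utility_le (utility_lt_addEdge_target hH hne (level_lt_addEdge_target hba hl)).le)]
  exact potential_addEdge_lt hG fun h => absurd h hba

/-- A profitable deletion splits a component, and a non-merging addition removes a missing edge. An
addition that merges components would raise the potential, but it is acceptable only if some pair is
incomparable, and then linking that pair is used instead. -/
lemma exists_step_potential_lt {g : Game} (hH : LevelsDominate g n) {G : EdgeSet n}
    (h : ¬ IsEquilibrium g G) :
    ∃ e : Fin n × Fin n, e.1 ≠ e.2 ∧ potential (step g G e) < potential G := by
  rw [isEquilibrium_iff] at h
  push Not at h
  obtain ⟨i, j, hne, h⟩ := h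
  by_cases hG : (i, j) ∈ G
  · have hu : utility g G i ≤ utility g (delEdge G i j) i := by
      by_contra hu
      exact (h fun _ => not_le.1 hu).1 hG
    obtain ⟨h₁, h₂⟩ := reach_and_not_reach_of_level_delEdge_lt hG
      ((level_delEdge_lt_iff hH hne hG).2 hu)
    exact ⟨(i, j), hne, by rw [step_of_mem hG hu]; exact potential_delEdge_lt hG h₁ h₂⟩
  · obtain ⟨-, hu, hacc⟩ := h fun h' => absurd h' hG
    by_cases hij : Reach G j i → Reach G i j
    · exact ⟨(i, j), hne, by rw [step_of_notMem hG hu hacc]; exact potential_addEdge_lt hG hij⟩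
    · push Not at hij
      by_cases htot : ∀ a b, Reach G a b ∨ Reach G b a
      · exact absurd hu (utility_addEdge_source_lt hH hG (level_addEdge_lt_of_total htot hij)).not_ge
      · push Not at htot
        obtain ⟨a, b, hab, hba⟩ := htot
        exact exists_step_of_incomparable hH hab hba

lemma IsNetwork.step {g : Game} {G : EdgeSet n} (hN : IsNetwork G) {e : Fin n × Fin n}
    (he : e.1 ≠ e.2) : IsNetwork (step g G e) := by
  unfold HierNet.step
  have hadd : IsNetwork (addEdge G e.1 e.2) := by
    intro e' he'
    rcases Finset.mem_insert.1 he' with rfl | he'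
    · exact he
    · exact hN _ he'
  have hdel : IsNetwork (delEdge G e.1 e.2) := fun e' he' => hN _ (delEdge_subset _ _ _ he')
  split_ifs <;> assumption

lemma foldl_step_eq {g : Game} {G : EdgeSet n} (h : IsEquilibrium g G)
    {w : List (Fin n × Fin n)} (hw : ∀ e ∈ w, e.1 ≠ e.2) : w.foldl (step g) G = G := by
  induction w with
  | nil => rfl
  | cons e w ih =>
    rw [List.foldl_cons, h.step_eq (hw e (by simp))]
    exact ih fun e' he' => hw e' (by simp [he'])

lemma exists_word {g : Game} (hH : LevelsDominate g n) (G : EdgeSet n) :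
    ∃ w : List (Fin n × Fin n), (∀ e ∈ w, e.1 ≠ e.2) ∧ IsEquilibrium g (w.foldl (step g) G) := by
  induction hk : potential G using Nat.strong_induction_on generalizing G with
  | _ k ih =>
    by_cases h : IsEquilibrium g G
    · exact ⟨[], by simp, h⟩
    · obtain ⟨e, he, hlt⟩ := exists_step_potential_lt hH h
      obtain ⟨w, hw, hE⟩ := ih _ (hk ▸ hlt) (step g G e) rfl
      exact ⟨e :: w, by simpa using ⟨he, fun a b hab => hw (a, b) hab⟩, hE⟩

/-- There is a sequence of selections that leads from every network to an equilibrium. -/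
lemma exists_universal_word {g : Game} (hH : LevelsDominate g n) :
    ∃ w : List (Fin n × Fin n), (∀ e ∈ w, e.1 ≠ e.2) ∧
      ∀ G : EdgeSet n, IsEquilibrium g (w.foldl (step g) G) := by
  classical
  suffices h : ∀ S : Finset (EdgeSet n), ∃ w : List (Fin n × Fin n), (∀ e ∈ w, e.1 ≠ e.2) ∧
      ∀ G ∈ S, IsEquilibrium g (w.foldl (step g) G) by
    obtain ⟨w, hw, hE⟩ := h Finset.univ
    exact ⟨w, hw, fun G => hE G (Finset.mem_univ _)⟩
  intro S
  induction S using Finset.induction_on with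
  | empty => exact ⟨[], by simp, by simp⟩
  | insert G S _ ih =>
    obtain ⟨w, hw, hE⟩ := ih
    obtain ⟨w', hw', hE'⟩ := exists_word hH (w.foldl (step g) G)
    -- The suffix `w'` settles `G`, while the networks already settled by `w` are fixed by it.
    refine ⟨w ++ w', fun e he => (List.mem_append.1 he).elim (hw e) (hw' e), fun G' hG' => ?_⟩
    rw [List.foldl_append]
    rcases Finset.mem_insert.1 hG' with rfl | hG'
    · exact hE'
    · rw [foldl_step_eq (hE G' hG') hw']
      exact hE G' hG'

/-! ### Absorption -/

lemma process_add (g : Game) (G₀ : EdgeSet n) (x : ℕ → Fin n × Fin n) (t : ℕ)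
    (w : List (Fin n × Fin n)) (hw : ∀ k : Fin w.length, x (t + k) = w.get k) :
    process g G₀ x (t + w.length) = w.foldl (step g) (process g G₀ x t) := by
  induction w generalizing t with
  | nil => rfl
  | cons e w ih =>
    have h₀ : x t = e := by simpa using hw ⟨0, by simp⟩
    have h₁ := ih (t + 1) fun k => by
      have := hw k.succ
      simpa [add_assoc, add_comm 1] using this
    rw [List.foldl_cons, List.length_cons, ← add_assoc, add_right_comm, h₁]
    rw [process, h₀]

lemma process_eq_of_isEquilibrium {g : Game} {G₀ : EdgeSet n} {x : ℕ → Fin n × Fin n}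
    (hx : ∀ t, (x t).1 ≠ (x t).2) {T : ℕ} (h : IsEquilibrium g (process g G₀ x T)) {t : ℕ}
    (ht : T ≤ t) : process g G₀ x t = process g G₀ x T := by
  induction t, ht using Nat.le_induction with
  | base => rfl
  | succ t _ ih => rw [process, ih, h.step_eq (hx t)]

lemma isNetwork_process {g : Game} {G₀ : EdgeSet n} (hG₀ : IsNetwork G₀)
    {x : ℕ → Fin n × Fin n} (hx : ∀ t, (x t).1 ≠ (x t).2) (t : ℕ) :
    IsNetwork (process g G₀ x t) := by
  induction t with
  | zero => exact hG₀
  | succ t ih => exact ih.step (hx t)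

end HierNet

open Filter in
/-- The infinite monkey theorem: a word whose letters have positive probability occurs almost
surely in a sequence of independent identically distributed letters. -/
theorem ProbabilityTheory.ae_exists_occurrence {α Ω : Type*} [MeasurableSpace α]
    [MeasurableSingletonClass α] [MeasurableSpace Ω] {P : Measure Ω} [IsProbabilityMeasure P]
    {X : ℕ → Ω → α} (hXmeas : ∀ t, Measurable (X t)) (hXindep : iIndepFun X P)
    {q : PMF α} (hXlaw : ∀ t, P.map (X t) = q.toMeasure) {L : ℕ} (w : Fin L → α)
    (hw : ∀ k, q (w k) ≠ 0) :
    ∀ᵐ ω ∂P, ∃ t, ∀ k : Fin L, X (t + k) ω = w k := by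
  have hsingle : ∀ t a, P (X t ⁻¹' {a}) = q a := fun t a => by
    rw [← Measure.map_apply (hXmeas t) (measurableSet_singleton a), hXlaw,
      PMF.toMeasure_apply_singleton _ _ (measurableSet_singleton a)]
  -- Time is cut into disjoint blocks of length `L`, whose events `E m` are independent.
  have hinj : Function.Injective fun p : ℕ × Fin L => p.1 * L + p.2 := by
    rintro ⟨m, k⟩ ⟨m', k'⟩ h
    have hL : 0 < L := k.pos
    have h₁ := congrArg (· / L) h
    have h₂ := congrArg (· % L) h
    simp only [Nat.mul_add_mod_of_lt k.2, Nat.mul_add_mod_of_lt k'.2] at h₂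
    simp only [Nat.mul_comm _ L, Nat.mul_add_div hL, Nat.div_eq_of_lt k.2,
      Nat.div_eq_of_lt k'.2] at h₁
    exact Prod.ext (by simpa using h₁) (Fin.ext (by simpa [Nat.mod_eq_of_lt] using h₂))
  have hind := hXindep.precomp hinj
  let E : ℕ → Set Ω := fun m => ⋂ k : Fin L, X (m * L + k) ⁻¹' {w k}
  have hEmeas : ∀ m, MeasurableSet (E m) := fun m =>
    MeasurableSet.iInter fun k => hXmeas _ (measurableSet_singleton _)
  have hinter : ∀ s : Finset ℕ, P (⋂ m ∈ s, E m) = ∏ _m ∈ s, ∏ k : Fin L, q (w k) := fun s => by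
    have h := hind.measure_inter_preimage_eq_mul (s ×ˢ Finset.univ)
      (sets := fun p => {w p.2}) fun _ _ => measurableSet_singleton _
    rw [Finset.prod_product] at h
    simp only [hsingle] at h
    rw [← h]
    congr 1
    ext ω
    simp only [E, Set.mem_iInter, Finset.mem_product, Finset.mem_univ, and_true]
    exact ⟨fun h p hp => h p.1 hp p.2, fun h m hm k => h (m, k) hm⟩
  have hE : ∀ m, P (E m) = ∏ k : Fin L, q (w k) := fun m => by simpa using hinter {m}
  have hEind : iIndepSet E P := by
    rw [iIndepSet_iff_meas_biInter hEmeas]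
    intro s
    simp only [hinter, hE]
  have hsum : ∑' m, P (E m) = ⊤ := by
    simp only [hE]
    exact ENNReal.tsum_const_eq_top_of_ne_zero (Finset.prod_ne_zero_iff.2 fun k _ => hw k)
  -- All blocks have the same positive probability, so the second Borel–Cantelli lemma applies.
  have hlim := measure_limsup_eq_one hEmeas hEind hsum
  have hae : ∀ᵐ ω ∂P, ω ∈ limsup E atTop :=
    (prob_compl_eq_zero_iff (MeasurableSet.measurableSet_limsup hEmeas)).2 hlim
  filter_upwards [hae] with ω hω
  obtain ⟨m, hm⟩ := (mem_limsup_iff_frequently_mem.1 hω).exists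
  exact ⟨m * L, fun k => by simpa using Set.mem_iInter.1 hm k⟩

open HierNet
theorem theorem3 {n : ℕ} (hn : 3 ≤ n) (g : Game)
    (hH : ∀ l : ℕ, l ≤ n - 1 → g.γ + g.c * (n : ℝ) < g.H (l + 1) - g.H l)
    (G₀ : EdgeSet n) (hG₀ : IsNetwork G₀)
    (q : PMF (Fin n × Fin n)) (hq : ∀ i j : Fin n, 0 < q (i, j) ↔ i ≠ j)
    {Ω : Type*} [MeasurableSpace Ω] (P : Measure Ω) [IsProbabilityMeasure P]
    (X : ℕ → Ω → Fin n × Fin n) (hXmeas : ∀ t, Measurable (X t))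
    (hXindep : iIndepFun X P) (hXlaw : ∀ t, P.map (X t) = q.toMeasure) :
    ∀ᵐ ω ∂P, ∃ (T : ℕ) (Gstar : EdgeSet n),
      (∀ t, T ≤ t → process g G₀ (fun s => X s ω) t = Gstar) ∧
      IsNetwork Gstar ∧ IsEquilibrium g Gstar ∧ IsConnected Gstar ∧
      (∀ i j : Fin n, ¬ IsCritical Gstar i j) ∧
      LimitForm g Gstar := by
  have hD : LevelsDominate g n := hH
  obtain ⟨w, hw, hE⟩ := exists_universal_word hD
  -- Equilibrium says nothing about pairs `(i, i)`, so absorption needs them never to be drawn.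
  have hoff : ∀ᵐ ω ∂P, ∀ t, (X t ω).1 ≠ (X t ω).2 := by
    rw [ae_all_iff]
    intro t
    have hsupp : ∀ᵐ e ∂q.toMeasure, e.1 ≠ e.2 := by
      rw [ae_iff, PMF.toMeasure_apply_eq_zero_iff _ (Set.toFinite _).measurableSet,
        Set.disjoint_left]
      rintro ⟨i, j⟩ hq' hij
      exact hij ((hq i j).1 (pos_iff_ne_zero.2 ((PMF.mem_support_iff _ _).1 hq')))
    rw [← hXlaw t] at hsupp
    exact ae_of_ae_map (hXmeas t).aemeasurable hsupp
  have hocc := ae_exists_occurrence hXmeas hXindep hXlaw w.get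
    fun k => ((hq _ _).2 (hw _ (List.get_mem w k))).ne'
  filter_upwards [hoff, hocc] with ω hne ⟨t, ht⟩
  -- The network at the random time `t` is unknown, which is why the word has to work from every
  -- network.
  have hproc := process_add g G₀ (fun s => X s ω) t w ht
  have hEq : IsEquilibrium g (process g G₀ (fun s => X s ω) (t + w.length)) := hproc ▸ hE _
  have hN := isNetwork_process (g := g) hG₀ hne (t + w.length)
  exact ⟨t + w.length, _, fun s hs => process_eq_of_isEquilibrium hne hEq hs, hN, hEq,
    hEq.isConnected hD, hEq.not_isCritical hD hN, hEq.limitForm hD hN⟩
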